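/- Let $B_3=\langle\sigma_1,\sigma_2\mid\sigma_1\sigma_2\sigma_1=\sigma_2\sigma_1\sigma_2\rangle$ be the braid group on three strands. Let $b_{-1}\colon B_3\to \mathrm{GL}_3(\mathbb{Z})$ be the integral Burau representation, $$b_{-1}(\sigma_1)=\begin{pmatrix}2&-1&0\\1&0&0\\0&0&1\end{pmatrix},\qquad b_{-1}(\sigma_2)=\begin{pmatrix}1&0&0\\0&2&-1\\0&1&0\end{pmatrix},$$ and let $\rho\colon B_3\to \mathrm{Sp}_2(\mathbb{Z})$ be its restriction to the invariant rank-two summand with basis $(1,1,0),(0,1,1)$. Let $B_3[3]$ be the level $3$ congruence subgroup, that is, the kernel of $\rho_3\colon B_3\to \mathrm{Sp}_2(\mathbb{Z}/3)$, the reduction of $\rho$ modulo $3$. A crystallographic group of dimension $N$ is a group isomorphic to a discrete and uniform (cocompact) subgroup $\Gamma$ of $\mathbb{R}^N\rtimes \mathrm{O}(N,\mathbb{R})$; its holonomy group is the image of $\Gamma$ in $\mathrm{O}(N,\mathbb{R})$, equivalently the finite quotient $F$ in the extension $1\to\mathbb{Z}^N\to\Gamma\to F\to 1$, where $\mathbb{Z}^N$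 is the subgroup of translations in $\Gamma$ and is maximal abelian in $\Gamma$. A Bieberbach group is a torsion-free crystallographic group. Then $B_3/[B_3[3],B_3[3]]$ is a Bieberbach group of dimension $4$ with holonomy group $\mathrm{PSp}_2(\mathbb{Z}/3)=\mathrm{Sp}_2(\mathbb{Z}/3)/Z(\mathrm{Sp}_2(\mathbb{Z}/3))$, which is isomorphic to the alternating group $A_4$. -/

import Mathlib

open Matrix

/-! ## The braid group on three strands -/

/-- The braid relation `σ₁σ₂σ₁ = σ₂σ₁σ₂`, as a relator in the free group on `σ₁, σ₂`
(indexed by `0, 1`). -/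
def braidRels3 : Set (FreeGroup (Fin 2)) :=
  {FreeGroup.of 0 * FreeGroup.of 1 * FreeGroup.of 0 *
    (FreeGroup.of 1 * FreeGroup.of 0 * FreeGroup.of 1)⁻¹}

/-- The braid group `B₃`, in Artin's presentation `⟨σ₁, σ₂ ∣ σ₁σ₂σ₁ = σ₂σ₁σ₂⟩`. -/
abbrev BraidGroup3 : Type := PresentedGroup braidRels3

/-- The Artin generators: `braidGen 0 = σ₁` and `braidGen 1 = σ₂`. -/
def braidGen (i : Fin 2) : BraidGroup3 := PresentedGroup.of i

/-- Two elements satisfying the braid relation define a homomorphism out of `B₃`. -/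
def braidLift {G : Type*} [Group G] (s : Fin 2 → G) (h : s 0 * s 1 * s 0 = s 1 * s 0 * s 1) :
    BraidGroup3 →* G :=
  PresentedGroup.toGroup (rels := braidRels3) (f := s) (by
    intro r hr
    rw [braidRels3, Set.mem_singleton_iff] at hr
    subst hr
    simp only [map_mul, map_inv, FreeGroup.lift_apply_of]
    rw [h, mul_inv_cancel])

theorem braidLift_gen {G : Type*} [Group G] (s : Fin 2 → G)
    (h : s 0 * s 1 * s 0 = s 1 * s 0 * s 1) (i : Fin 2) : braidLift s h (braidGen i) = s i :=
  PresentedGroup.toGroup.of _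

/-! ## The Burau representation and the symplectic representation -/

/-- The Burau matrices of `σ₁` and `σ₂` over a commutative ring, at an invertible parameter `t`. -/
def burauGen {R : Type*} [CommRing R] (t : Rˣ) : Fin 2 → GL (Fin 3) R :=
  ![⟨!![1 - (t : R), (t : R), 0; 1, 0, 0; 0, 0, 1],
     !![0, 1, 0; (↑t⁻¹ : R), 1 - (↑t⁻¹ : R), 0; 0, 0, 1],
     by ext i j; fin_cases i <;> fin_cases j <;> simp [Matrix.mul_apply, Fin.sum_univ_three, mul_sub],
     by ext i j; fin_cases i <;> fin_cases j <;>
          simp [Matrix.mul_apply, Fin.sum_univ_three, mul_sub]⟩,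
    ⟨!![1, 0, 0; 0, 1 - (t : R), (t : R); 0, 1, 0],
     !![1, 0, 0; 0, 0, 1; 0, (↑t⁻¹ : R), 1 - (↑t⁻¹ : R)],
     by ext i j; fin_cases i <;> fin_cases j <;> simp [Matrix.mul_apply, Fin.sum_univ_three, mul_sub],
     by ext i j; fin_cases i <;> fin_cases j <;>
          simp [Matrix.mul_apply, Fin.sum_univ_three, mul_sub]⟩]

/-- The (unreduced) Burau representation `b_t : B₃ → GL₃(R)` at an invertible parameter `t`. The
generic Burau representation is the case `R = ℤ[t, t⁻¹]`. -/
def burau {R : Type*} [CommRing R] (t : Rˣ) : BraidGroup3 →* GL (Fin 3) R :=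
  braidLift (burauGen t) (by
    ext i j
    fin_cases i <;> fin_cases j <;>
      simp [burauGen, Matrix.mul_apply, Fin.sum_univ_three] <;> ring)

/-- The integral Burau representation `b₋₁ : B₃ → GL₃(ℤ)`. -/
def integralBurau : BraidGroup3 →* GL (Fin 3) ℤ := burau (-1)

/-- The symplectic group `Sp₂(R)`. -/
abbrev Sp2 (R : Type*) [CommRing R] : Type _ := Matrix.symplecticGroup (Fin 1) R

/-- The projective symplectic group `PSp₂(R)`, the quotient of `Sp₂(R)` by its center. -/
abbrev PSp2 (R : Type*) [CommRing R] : Type _ := Sp2 R ⧸ Subgroup.center (Sp2 R)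

/-- The images of `σ₁` and `σ₂` in `Sp₂(ℤ)`. -/
def rhoGen : Fin 2 → Sp2 ℤ :=
  ![⟨fromBlocks !![1] !![-1] !![0] !![1], SymplecticGroup.fromBlocks_mem_iff.2 (by decide)⟩,
    ⟨fromBlocks !![1] !![0] !![1] !![1], SymplecticGroup.fromBlocks_mem_iff.2 (by decide)⟩]

/-- The representation `ρ : B₃ → Sp₂(ℤ)`. It is the integral Burau representation, restricted to
the invariant plane spanned by `(1, 1, 0)` and `(0, 1, 1)`, which has the invariant complement
spanned by the fixed vector `(1, 1, 1)`: see `integralBurau_mul_burauBasis`. -/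
def rho : BraidGroup3 →* Sp2 ℤ :=
  braidLift rhoGen (Subtype.ext (by decide))

/-- The basis `(1, 1, 0), (0, 1, 1), (1, 1, 1)` of `ℤ³`, as the columns of a matrix. -/
def burauBasis : Matrix (Fin 3) ((Fin 1 ⊕ Fin 1) ⊕ Fin 1) ℤ :=
  fun i => Sum.elim (Sum.elim ![![1, 1, 0] i] ![![0, 1, 1] i]) ![![1, 1, 1] i]

/-- `burauBasis` is a basis of `ℤ³`. -/
theorem burauBasis_invertible : ∃ Q : Matrix ((Fin 1 ⊕ Fin 1) ⊕ Fin 1) (Fin 3) ℤ,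
    burauBasis * Q = 1 ∧ Q * burauBasis = 1 :=
  ⟨Sum.elim (Sum.elim ![![0, 1, -1]] ![![-1, 1, 0]]) ![![1, -1, 1]], by decide, by decide⟩

/-- The direct sum of `ρ` and the trivial representation of rank one. -/
def rhoPlusOne (g : BraidGroup3) :
    Matrix ((Fin 1 ⊕ Fin 1) ⊕ Fin 1) ((Fin 1 ⊕ Fin 1) ⊕ Fin 1) ℤ :=
  fromBlocks (rho g : Matrix (Fin 1 ⊕ Fin 1) (Fin 1 ⊕ Fin 1) ℤ) 0 0 1

theorem rhoPlusOne_one : rhoPlusOne 1 = 1 := by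
  rw [rhoPlusOne, map_one]
  exact fromBlocks_one

theorem rhoPlusOne_mul (a b : BraidGroup3) :
    rhoPlusOne (a * b) = rhoPlusOne a * rhoPlusOne b := by
  simp only [rhoPlusOne, map_mul, Submonoid.coe_mul]
  rw [fromBlocks_multiply]
  simp

/-- In the basis `burauBasis` the integral Burau representation is the direct sum of `ρ` and the
trivial representation of rank one. -/
theorem integralBurau_mul_burauBasis (g : BraidGroup3) :
    (integralBurau g : Matrix (Fin 3) (Fin 3) ℤ) * burauBasis = burauBasis * rhoPlusOne g := by
  let S : Subgroup BraidGroup3 :=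
    { carrier := {g | (integralBurau g : Matrix (Fin 3) (Fin 3) ℤ) * burauBasis =
        burauBasis * rhoPlusOne g}
      one_mem' := by
        change ((integralBurau 1 : GL (Fin 3) ℤ) : Matrix (Fin 3) (Fin 3) ℤ) * burauBasis =
          burauBasis * rhoPlusOne 1
        rw [map_one, rhoPlusOne_one, Matrix.mul_one, Units.val_one, Matrix.one_mul]
      mul_mem' := by
        intro a b ha hb
        change (integralBurau (a * b) : Matrix (Fin 3) (Fin 3) ℤ) * burauBasis =
          burauBasis * rhoPlusOne (a * b)
        change (integralBurau a : Matrix (Fin 3) (Fin 3) ℤ) * burauBasis =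
          burauBasis * rhoPlusOne a at ha
        change (integralBurau b : Matrix (Fin 3) (Fin 3) ℤ) * burauBasis =
          burauBasis * rhoPlusOne b at hb
        rw [map_mul, rhoPlusOne_mul, Units.val_mul, Matrix.mul_assoc, hb, ← Matrix.mul_assoc, ha,
          Matrix.mul_assoc]
      inv_mem' := by
        intro a ha
        change (integralBurau a : Matrix (Fin 3) (Fin 3) ℤ) * burauBasis =
          burauBasis * rhoPlusOne a at ha
        change (integralBurau a⁻¹ : Matrix (Fin 3) (Fin 3) ℤ) * burauBasis =
          burauBasis * rhoPlusOne a⁻¹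
        have h1 : (integralBurau a⁻¹ : Matrix (Fin 3) (Fin 3) ℤ) *
            (integralBurau a : Matrix (Fin 3) (Fin 3) ℤ) = 1 := by
          rw [← Units.val_mul, ← map_mul, inv_mul_cancel, map_one, Units.val_one]
        have h2 : rhoPlusOne a * rhoPlusOne a⁻¹ = 1 := by
          rw [← rhoPlusOne_mul, mul_inv_cancel, rhoPlusOne_one]
        have h3 : burauBasis =
            (integralBurau a : Matrix (Fin 3) (Fin 3) ℤ) * (burauBasis * rhoPlusOne a⁻¹) := by
          rw [← Matrix.mul_assoc, ha, Matrix.mul_assoc, h2, Matrix.mul_one]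
        conv_lhs => rw [h3]
        rw [← Matrix.mul_assoc, h1, Matrix.one_mul] }
  have hS : (⊤ : Subgroup BraidGroup3) ≤ S := by
    rw [← PresentedGroup.closure_range_of braidRels3, Subgroup.closure_le]
    rintro _ ⟨i, rfl⟩
    change (integralBurau (braidGen i) : Matrix (Fin 3) (Fin 3) ℤ) * burauBasis =
      burauBasis * rhoPlusOne (braidGen i)
    rw [integralBurau, burau, rhoPlusOne, rho, braidLift_gen, braidLift_gen]
    fin_cases i <;> decide
  exact hS (Subgroup.mem_top g)

/-- Reduction modulo `m`, as a homomorphism `Sp₂(ℤ) → Sp₂(ℤ/m)`. -/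
def Sp2.reduction (m : ℕ) : Sp2 ℤ →* Sp2 (ZMod m) where
  toFun A := ⟨(A : Matrix (Fin 1 ⊕ Fin 1) (Fin 1 ⊕ Fin 1) ℤ).map (Int.castRingHom (ZMod m)),
    SymplecticGroup.map_mem A.2 _⟩
  map_one' := Subtype.ext (by simp)
  map_mul' _ _ := Subtype.ext Matrix.map_mul

/-- The representation `ρ_m : B₃ → Sp₂(ℤ/m)`. -/
def rhoMod (m : ℕ) : BraidGroup3 →* Sp2 (ZMod m) := (Sp2.reduction m).comp rho

/-- The level `m` congruence subgroup `B₃[m]` of `B₃`, the kernel of `ρ_m`. -/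
def congruenceBraid3 (m : ℕ) : Subgroup BraidGroup3 := (rhoMod m).ker

instance congruenceBraid3_normal (m : ℕ) : (congruenceBraid3 m).Normal :=
  MonoidHom.normal_ker (rhoMod m)

/-- The quotient `B₃ / [B₃[m], B₃[m]]`. -/
abbrev CongruenceQuotient3 (m : ℕ) : Type :=
  BraidGroup3 ⧸ ⁅congruenceBraid3 m, congruenceBraid3 m⁆

/-! ## Crystallographic and Bieberbach groups -/

/-- Euclidean space `ℝᴺ`. -/
abbrev Euc (N : ℕ) : Type := EuclideanSpace ℝ (Fin N)

/-- The group `ℝᴺ ⋊ O(N)` of isometries of `ℝᴺ`. -/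
abbrev EucIsom (N : ℕ) : Type := Euc N ≃ᵃⁱ[ℝ] Euc N

/-- The projection `ℝᴺ ⋊ O(N) → O(N)`. -/
noncomputable def EucIsom.linearPart (N : ℕ) : EucIsom N →* (Euc N ≃ₗᵢ[ℝ] Euc N) where
  toFun g := g.linearIsometryEquiv
  map_one' := rfl
  map_mul' _ _ := rfl

/-- The translation part and the linear part of an isometry. -/
noncomputable def EucIsom.parts (N : ℕ) (g : EucIsom N) : Euc N × (Euc N →L[ℝ] Euc N) :=
  (g 0, (g.linearIsometryEquiv.toContinuousLinearEquiv : Euc N →L[ℝ] Euc N))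

/-- The usual topology of `ℝᴺ ⋊ O(N)`, that is the product topology. -/
noncomputable instance EucIsom.topologicalSpace (N : ℕ) : TopologicalSpace (EucIsom N) :=
  TopologicalSpace.induced (EucIsom.parts N) inferInstance

/-- `Γ` is a discrete and uniform (cocompact) subgroup of `ℝᴺ ⋊ O(N)`. -/
structure IsCrystallographicSubgroup {N : ℕ} (Γ : Subgroup (EucIsom N)) : Prop where
  discrete : DiscreteTopology Γ
  uniform : CompactSpace (EucIsom N ⧸ Γ)

/-- The subgroup of translations in `Γ`. -/
noncomputable def translationSubgroup {N : ℕ} (Γ : Subgroup (EucIsom N)) : Subgroup Γ :=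
  ((EucIsom.linearPart N).comp Γ.subtype).ker

/-- The holonomy group of `Γ`, its image in `O(N)`; it is the quotient of `Γ` by its subgroup of
translations. -/
noncomputable def holonomyGroup {N : ℕ} (Γ : Subgroup (EucIsom N)) : Subgroup (Euc N ≃ₗᵢ[ℝ] Euc N) :=
  Γ.map (EucIsom.linearPart N)

/-- `G` is a crystallographic group: for some `N` it is isomorphic to a discrete and uniform
subgroup of `ℝᴺ ⋊ O(N)`. -/
def IsCrystallographicGroup (G : Type*) [Group G] : Prop :=
  ∃ (N : ℕ) (Γ : Subgroup (EucIsom N)), IsCrystallographicSubgroup Γ ∧ Nonempty (G ≃* Γ)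

/-- A Bieberbach group is a torsion-free crystallographic group. -/
def IsBieberbachGroup (G : Type*) [Group G] : Prop :=
  IsCrystallographicGroup G ∧ ∀ g : G, IsOfFinOrder g → g = 1

/-- `G` is a crystallographic group of dimension `N` with holonomy group `F`: it is isomorphic to
a discrete and uniform subgroup `Γ` of `ℝᴺ ⋊ O(N)` whose image in `O(N)` is isomorphic to `F`.
The translations in `Γ` form the kernel of the extension `1 → ℤᴺ → Γ → F → 1`, with `F` finite and
`ℤᴺ` maximal abelian in `Γ`. -/
def IsCrystallographicOfDimWithHolonomy (N : ℕ) (F : Type*) [Group F] (G : Type*) [Group G] :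
    Prop :=
  ∃ Γ : Subgroup (EucIsom N), IsCrystallographicSubgroup Γ ∧ Nonempty (G ≃* Γ) ∧
    Nonempty (holonomyGroup Γ ≃* F) ∧ Finite F ∧
    Nonempty (translationSubgroup Γ ≃* Multiplicative (Fin N → ℤ)) ∧
    Maximal (fun A : Subgroup Γ => IsMulCommutative A) (translationSubgroup Γ)

/-! The subgroup `B₃[3]` is the normal closure of `σ₁³`. Modulo that closure every element is
`zᵏaⁱw`, with `z` the full twist, `k < 2`, `i < 3` and `w` one of four words (`exists_tetraWord`).
These are at most 24 classes, and `ρ₃` is nontrivial on each of them but the identity, so its kernel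
is no larger (`congruenceBraid3_three`).

Modulo commutators, conjugation permutes four conjugates of `σ₁³`, which therefore generate the
abelianization of `B₃[3]` (`toQuotient_conj_cuspElt`, `exists_cuspProd`). Their independence comes
from an explicit affine action on `ℝ⁴`, `affineRep`, with permutations as linear parts: the four
conjugates become the unit translations and the full twist becomes the translation by `(½, ½, ½,
½)`. Comparison with the normal form makes the action faithful on the quotient
(`quotientRep_injective`). Its image is discrete because coordinates stay in `⅙ℤ`, and cocompact
because it contains `ℤ⁴`.

The translation lattice is `ℤ⁴ + ℤ(½, ½, ½, ½)`, larger than the image of `B₃[3]` by the central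
full twist; this is why the holonomy is `PSp₂` and not `Sp₂`. Both `PSp₂(ℤ/3)` and the holonomy are
images of `B₃` with the same kernel (`ker_projRep`), and the permutations that occur form `A₄`.
Torsion is excluded by a divisibility property of sixth powers (`affineRep_eq_one_of_isOfFinOrder`).
-/

/-- The words `aⁱ w` with `w ∈ {1, b, ba, ba²}`; they represent the elements of the tetrahedral
group `⟨a, b ∣ a³ = b³ = (aba)² = 1, aba = bab⟩`. -/
def tetraWord {Q : Type*} [Group Q] (a b : Q) (i : Fin 3) (j : Fin 4) : Q :=
  a ^ (i : ℕ) * (![1, b, b * a, b * a * a] : Fin 4 → Q) j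

theorem map_tetraWord {Q R : Type*} [Group Q] [Group R] (f : Q →* R) (a b : Q) (i : Fin 3)
    (j : Fin 4) : f (tetraWord a b i j) = tetraWord (f a) (f b) i j := by
  fin_cases j <;> simp [tetraWord]

/-! ### Groups generated by two braided elements with trivial cubes -/

section
variable {Q : Type*} [Group Q] {a b : Q}

theorem fullTwist_commute_left (h : a * b * a = b * a * b) :
    Commute ((a * b * a) ^ 2) a := by
  have h1 : a * b * a * b = a * (a * b * a) := by
    rw [mul_assoc, mul_assoc, ← mul_assoc b a b, ← h]
  have h2 : (a * b * a) * a = b * (a * b * a) := by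
    conv_lhs => rw [h]
    simp only [mul_assoc]
  have : (a * b * a) ^ 2 * a = a * (a * b * a) ^ 2 := by
    rw [pow_two, mul_assoc, h2, ← mul_assoc, h1, mul_assoc]
  exact this

theorem fullTwist_commute_right (h : a * b * a = b * a * b) :
    Commute ((a * b * a) ^ 2) b := by
  rw [h]; exact fullTwist_commute_left h.symm

/-- The full twist is `z = a(baab)a` and commutes with `a`, so `baab = z a⁻²`, and `a⁻² = a`. -/
theorem braid_mul_sq_mul (ha : a ^ 3 = 1) (h : a * b * a = b * a * b) :
    b * a * a * b = (a * b * a) ^ 2 * a := by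
  have h1 : (a * b * a) ^ 2 = a * (b * a * a * b) * a := by
    simp only [pow_two, mul_assoc]
  have h2 := fullTwist_commute_left h
  have h3 : (a * b * a) ^ 2 * a = a⁻¹ * (a * b * a) ^ 2 * a⁻¹ := by
    rw [← h2.inv_right.eq, mul_assoc _ a⁻¹]
    congr 1
    rw [← _root_.mul_inv_rev, eq_inv_iff_mul_eq_one, ← mul_assoc, ← pow_three']
    exact ha
  rw [h3, h1]
  group

/-- The previous identity and its mirror image under `a ↔ b` each express `b⁻¹` through `a⁻¹ba⁻¹`,
once with factor `z⁻¹` and once with factor `z`; hence `z = z⁻¹`. -/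
theorem fullTwist_sq (ha : a ^ 3 = 1) (hb : b ^ 3 = 1) (h : a * b * a = b * a * b) :
    ((a * b * a) ^ 2) ^ 2 = 1 := by
  have e1 := braid_mul_sq_mul ha h
  have e2 := braid_mul_sq_mul hb h.symm
  rw [← h] at e2
  have ca := fullTwist_commute_left h
  generalize (a * b * a) ^ 2 = z at *
  rw [pow_three'] at ha hb
  have hb' : b * b = b⁻¹ := by rw [eq_inv_iff_mul_eq_one]; exact hb
  have ha' : a * a = a⁻¹ := by rw [eq_inv_iff_mul_eq_one]; exact ha
  rw [mul_assoc b, ha'] at e1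
  rw [mul_assoc a, hb'] at e2
  have k1 : b⁻¹ = z⁻¹ * (a⁻¹ * b * a⁻¹) := by
    have : b⁻¹ = (z * a)⁻¹ * (b * a⁻¹ * b) * b⁻¹ := by rw [e1]; group
    rw [this, ca.eq]; group
  have k2 : b⁻¹ = z * (a⁻¹ * b * a⁻¹) := by
    have : b⁻¹ = a⁻¹ * (a * b⁻¹ * a) * a⁻¹ := by group
    rw [this, e2, ← mul_assoc, ← ca.inv_right.eq]; group
  have k3 : z = z⁻¹ := mul_right_cancel (k2.symm.trans k1)
  rw [pow_two]
  nth_rw 1 [k3]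
  exact inv_mul_cancel z

/-- The set of normal forms is stable under right multiplication by `a` and by `b`, thanks to `b² =
z a² (ba²)`, `bab = a (ba)` and `ba²b = z a`. Inverses of the generators are their squares. -/
theorem exists_tetraWord (ha : a ^ 3 = 1) (hb : b ^ 3 = 1) (h : a * b * a = b * a * b)
    (hcl : Subgroup.closure {a, b} = ⊤) (g : Q) :
    ∃ (k : Fin 2) (i : Fin 3) (j : Fin 4), g = ((a * b * a) ^ 2) ^ (k : ℕ) * tetraWord a b i j := by
  have hz := fullTwist_sq ha hb h
  have e1 := braid_mul_sq_mul ha h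
  have ca := fullTwist_commute_left h
  have cb := fullTwist_commute_right h
  have hbb : b * a * b = a * b * a := h.symm
  generalize (a * b * a) ^ 2 = z at *
  have hred : ∀ (k i : ℕ) (j : Fin 4) (x : Q),
      x = z ^ k * (a ^ i * (![1, b, b * a, b * a * a] : Fin 4 → Q) j) →
      ∃ (k : Fin 2) (i : Fin 3) (j : Fin 4), x = z ^ (k : ℕ) * tetraWord a b i j := by
    intro k i j x hx
    refine ⟨⟨k % 2, Nat.mod_lt _ (by norm_num)⟩, ⟨i % 3, Nat.mod_lt _ (by norm_num)⟩, j, ?_⟩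
    rw [hx, tetraWord, pow_eq_pow_mod k hz, pow_eq_pow_mod i ha]
  have step_a : ∀ x : Q, (∃ (k : Fin 2) (i : Fin 3) (j : Fin 4),
      x = z ^ (k : ℕ) * tetraWord a b i j) →
      ∃ (k : Fin 2) (i : Fin 3) (j : Fin 4), x * a = z ^ (k : ℕ) * tetraWord a b i j := by
    rintro _ ⟨k, i, j, rfl⟩
    fin_cases j
    · exact hred k (i + 1) 0 _ (by simp [tetraWord, pow_succ, mul_assoc])
    · exact hred k i 2 _ (by simp [tetraWord, mul_assoc])
    · exact hred k i 3 _ (by simp [tetraWord, mul_assoc])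
    · refine hred k i 1 _ ?_
      rw [pow_three] at ha
      simp [tetraWord, mul_assoc, ha]
  have hb2 : b * b = z * (a ^ 2 * (b * a * a)) := by
    have hb' : b * b = b⁻¹ := by rw [eq_inv_iff_mul_eq_one, ← pow_three']; exact hb
    have e2 : b * a * a = z * a * b⁻¹ := by rw [← e1]; group
    have hzz : z * z = 1 := by rw [← pow_two]; exact hz
    rw [hb', e2]
    calc b⁻¹ = (z * z) * a ^ 3 * b⁻¹ := by rw [hzz, ha]; simp
      _ = z * (z * a ^ 2) * a * b⁻¹ := by group
      _ = z * (a ^ 2 * z) * a * b⁻¹ := by rw [(ca.pow_right 2).eq]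
      _ = _ := by group
  have step_b : ∀ x : Q, (∃ (k : Fin 2) (i : Fin 3) (j : Fin 4),
      x = z ^ (k : ℕ) * tetraWord a b i j) →
      ∃ (k : Fin 2) (i : Fin 3) (j : Fin 4), x * b = z ^ (k : ℕ) * tetraWord a b i j := by
    rintro _ ⟨k, i, j, rfl⟩
    fin_cases j
    · exact hred k i 1 _ (by simp [tetraWord, mul_assoc])
    · refine hred (k + 1) (i + 2) 3 _ ?_
      have : z ^ (k : ℕ) * tetraWord a b i 1 * b = z ^ (k : ℕ) * (a ^ (i : ℕ) * (b * b)) := by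
        simp [tetraWord, mul_assoc]
      refine this.trans ?_
      rw [hb2, ← mul_assoc _ z, ← (ca.pow_right _).eq, pow_succ z k,
        pow_add a i 2]
      simp [mul_assoc]
    · refine hred k (i + 1) 2 _ ?_
      have : z ^ (k : ℕ) * tetraWord a b i 2 * b = z ^ (k : ℕ) * (a ^ (i : ℕ) * (b * a * b)) := by
        simp [tetraWord, mul_assoc]
      refine this.trans ?_
      rw [hbb]
      simp [mul_assoc, pow_succ]
    · refine hred (k + 1) (i + 1) 0 _ ?_
      have : z ^ (k : ℕ) * tetraWord a b i 3 * b =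
          z ^ (k : ℕ) * (a ^ (i : ℕ) * (b * a * a * b)) := by
        simp [tetraWord, mul_assoc]
      refine this.trans ?_
      rw [e1, ← mul_assoc _ z, ← (ca.pow_right _).eq, pow_succ, pow_succ]
      simp [mul_assoc]
  have ha' : a⁻¹ = a * a := by rw [inv_eq_iff_mul_eq_one, ← mul_assoc, ← pow_three']; exact ha
  have hb' : b⁻¹ = b * b := by rw [inv_eq_iff_mul_eq_one, ← mul_assoc, ← pow_three']; exact hb
  have hg : g ∈ Subgroup.closure {a, b} := hcl ▸ Subgroup.mem_top g
  induction hg using Subgroup.closure_induction_right with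
  | one => exact ⟨0, 0, 0, by simp [tetraWord]⟩
  | mul_right x _ y hy ih =>
    rcases hy with rfl | rfl
    · exact step_a _ ih
    · exact step_b _ ih
  | mul_inv_cancel x _ y hy ih =>
    rcases hy with rfl | rfl
    · rw [ha', ← mul_assoc]; exact step_a _ (step_a _ ih)
    · rw [hb', ← mul_assoc]; exact step_b _ (step_b _ ih)

end

/-! ### The level three congruence subgroup as a normal closure -/

theorem braidGen_braid :
    braidGen 0 * braidGen 1 * braidGen 0 = braidGen 1 * braidGen 0 * braidGen 1 := by
  have := PresentedGroup.one_of_mem (rels := braidRels3) (x := _) (Set.mem_singleton _)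
  rw [map_mul, map_inv, mul_inv_eq_one] at this
  simp only [map_mul] at this
  exact this

theorem closure_braidGen : Subgroup.closure {braidGen 0, braidGen 1} = ⊤ := by
  rw [← PresentedGroup.closure_range_of braidRels3]
  congr 1
  ext x
  simp [Set.mem_range, Fin.exists_fin_two, braidGen, eq_comm]

/-- The central full twist `Δ² = (σ₁σ₂σ₁)²`. -/
def fullTwist : BraidGroup3 := (braidGen 0 * braidGen 1 * braidGen 0) ^ 2

/-- The normal closure of `σ₁³`. -/
def cubeClosure : Subgroup BraidGroup3 := Subgroup.normalClosure {braidGen 0 ^ 3}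

instance : cubeClosure.Normal := Subgroup.normalClosure_normal

theorem braidGen_zero_cube_mem : braidGen 0 ^ 3 ∈ cubeClosure :=
  Subgroup.subset_normalClosure rfl

theorem braidGen_one_eq_conj : braidGen 1 =
    (braidGen 0 * braidGen 1) * braidGen 0 * (braidGen 0 * braidGen 1)⁻¹ := by
  rw [eq_mul_inv_iff_mul_eq, ← mul_assoc, braidGen_braid]

theorem braidGen_one_cube_mem : braidGen 1 ^ 3 ∈ cubeClosure := by
  rw [braidGen_one_eq_conj, conj_pow]
  exact Subgroup.Normal.conj_mem inferInstance _ braidGen_zero_cube_mem _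

theorem exists_braid_normal_form (g : BraidGroup3) :
    ∃ n ∈ cubeClosure, ∃ (k : Fin 2) (i : Fin 3) (j : Fin 4),
      g = n * (fullTwist ^ (k : ℕ) * tetraWord (braidGen 0) (braidGen 1) i j) := by
  let q := QuotientGroup.mk' cubeClosure
  obtain ⟨k, i, j, h⟩ := exists_tetraWord (a := q (braidGen 0)) (b := q (braidGen 1))
    (by rw [← map_pow]; exact (QuotientGroup.eq_one_iff _).2 braidGen_zero_cube_mem)
    (by rw [← map_pow]; exact (QuotientGroup.eq_one_iff _).2 braidGen_one_cube_mem)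
    (by simp only [← map_mul, braidGen_braid])
    (by
      rw [← Set.image_pair, ← MonoidHom.map_closure, closure_braidGen, ← MonoidHom.range_eq_map,
        MonoidHom.range_eq_top]
      exact QuotientGroup.mk'_surjective _) (q g)
  refine ⟨g * (fullTwist ^ (k : ℕ) * tetraWord (braidGen 0) (braidGen 1) i j)⁻¹, ?_, k, i, j,
    (inv_mul_cancel_right _ _).symm⟩
  rw [← QuotientGroup.eq_one_iff]
  change q _ = 1
  rw [map_mul, map_inv, mul_inv_eq_one, h, map_mul, map_tetraWord, fullTwist, map_pow, map_pow,
    map_mul, map_mul]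

theorem cubeClosure_le_ker {G : Type*} [Group G] (f : BraidGroup3 →* G)
    (h : f (braidGen 0) ^ 3 = 1) : cubeClosure ≤ f.ker :=
  Subgroup.normalClosure_le_normal (by simpa [MonoidHom.mem_ker] using h)

theorem rhoMod_gen (m : ℕ) (i : Fin 2) :
    rhoMod m (braidGen i) = Sp2.reduction m (rhoGen i) := by
  rw [rhoMod, MonoidHom.comp_apply, rho, braidLift_gen]

theorem rhoMod_three_cube : rhoMod 3 (braidGen 0) ^ 3 = 1 := by
  rw [rhoMod_gen]; exact Subtype.ext (by decide)

/-- `ρ₃` separates the twenty-four normal forms from the identity. -/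
theorem rhoMod_three_normal_form_eq_one (k : Fin 2) (i : Fin 3) (j : Fin 4)
    (h : rhoMod 3 (fullTwist ^ (k : ℕ) * tetraWord (braidGen 0) (braidGen 1) i j) = 1) :
    k = 0 ∧ i = 0 ∧ j = 0 := by
  rw [fullTwist, map_mul, map_tetraWord, map_pow, map_pow, map_mul, map_mul, rhoMod_gen,
    rhoMod_gen] at h
  rw [Subtype.ext_iff] at h
  revert k i j
  decide

/-- An element of the kernel is `n` times a normal form with `n` in the closure; `ρ₃` kills `n`, so
it kills the normal form, which must then be trivial. -/
theorem congruenceBraid3_three : congruenceBraid3 3 = cubeClosure := by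
  apply le_antisymm
  · intro g hg
    obtain ⟨n, hn, k, i, j, rfl⟩ := exists_braid_normal_form g
    have hn' := cubeClosure_le_ker (rhoMod 3) rhoMod_three_cube hn
    rw [MonoidHom.mem_ker] at hn'
    rw [congruenceBraid3, MonoidHom.mem_ker, map_mul, hn', one_mul] at hg
    obtain ⟨rfl, rfl, rfl⟩ := rhoMod_three_normal_form_eq_one k i j hg
    simpa [tetraWord] using hn
  · exact cubeClosure_le_ker _ rhoMod_three_cube

/-! ### The affine representation -/

/-- The action of permutations on integer vectors, `(p • v) i = v (p⁻¹ i)`. -/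
def permAction : Equiv.Perm (Fin 4) →* MulAut (Multiplicative (Fin 4 → ℤ)) where
  toFun p :=
    { toFun := fun v => Multiplicative.ofAdd fun i => v.toAdd (p⁻¹ i)
      invFun := fun v => Multiplicative.ofAdd fun i => v.toAdd (p i)
      left_inv := fun v => by ext i; simp
      right_inv := fun v => by ext i; simp
      map_mul' := fun v w => rfl }
  map_one' := rfl
  map_mul' p q := by ext v i; simp

/-- The group of affine maps of `ℤ⁴` with a permutation as linear part. -/
abbrev PermAffine : Type := Multiplicative (Fin 4 → ℤ) ⋊[permAction] Equiv.Perm (Fin 4)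

/-- The affine map `x ↦ p x + v`. -/
def permAffine (v : Fin 4 → ℤ) (p : Equiv.Perm (Fin 4)) : PermAffine :=
  ⟨Multiplicative.ofAdd v, p⟩

theorem permAffine_mul (v w : Fin 4 → ℤ) (p q : Equiv.Perm (Fin 4)) :
    permAffine v p * permAffine w q = permAffine (fun i => v i + w (p⁻¹ i)) (p * q) := rfl

theorem permAffine_one : permAffine 0 1 = 1 := rfl

theorem permAffine_inj {v w : Fin 4 → ℤ} {p q : Equiv.Perm (Fin 4)} :
    permAffine v p = permAffine w q ↔ v = w ∧ p = q := by
  constructor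
  · intro h
    exact ⟨congrArg (fun g : PermAffine => g.left.toAdd) h, congrArg SemidirectProduct.right h⟩
  · rintro ⟨rfl, rfl⟩; rfl

theorem exists_permAffine (g : PermAffine) : ∃ v p, g = permAffine v p := ⟨g.left.toAdd, g.right, rfl⟩

/-- The vectors as a group of translations. -/
def translationHom : Multiplicative (Fin 4 → ℤ) →* PermAffine := SemidirectProduct.inl

theorem translationHom_apply (v : Fin 4 → ℤ) :
    translationHom (Multiplicative.ofAdd v) = permAffine v 1 := rfl

/-- The affine maps by which the generators of the braid group act, in units of one sixth. -/
def affineGen : Fin 2 → PermAffine :=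
  -- Each cube must be 6 times the basis vector at the fixed point of the 3-cycle: this gives the
  -- entry 2 there and sum zero over the cycle. With these vectors for `σ₁`, the braid relation
  -- forces the entry 1 in the second vector; splitting the remaining `-1` as `0` and `-1` is a
  -- choice of origin.
  ![permAffine ![2, 0, 0, 0] c[1, 2, 3], permAffine ![0, 2, 1, -1] c[0, 3, 2]]

/-- The action of the braid group on `ℤ⁴` by affine maps. -/
def affineRep : BraidGroup3 →* PermAffine :=
  braidLift affineGen (SemidirectProduct.ext (by decide) (by decide))

theorem affineRep_gen (i : Fin 2) : affineRep (braidGen i) = affineGen i := braidLift_gen _ _ _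

theorem affineRep_fullTwist : affineRep fullTwist = permAffine (fun _ => 3) 1 := by
  rw [fullTwist, map_pow, map_mul, map_mul, affineRep_gen, affineRep_gen]
  exact SemidirectProduct.ext (by decide) (by decide)

/-- The permutation of the four cusps. -/
def permRep : BraidGroup3 →* Equiv.Perm (Fin 4) := SemidirectProduct.rightHom.comp affineRep

/-! ### The cusp elements -/

/-- Conjugates of `σ₁³` whose classes generate `B₃[3]` modulo commutators. -/
def cuspElt : Fin 4 → BraidGroup3 :=
  ![braidGen 0 ^ 3, braidGen 1 ^ 3, braidGen 0 * braidGen 1 ^ 3 * (braidGen 0)⁻¹,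
    braidGen 0 ^ 2 * braidGen 1 ^ 3 * (braidGen 0 ^ 2)⁻¹]

theorem affineRep_cuspElt (i : Fin 4) : affineRep (cuspElt i) = permAffine (Pi.single i 6) 1 := by
  have h : ∀ i, affineRep (cuspElt i) = (![affineGen 0 ^ 3, affineGen 1 ^ 3,
      affineGen 0 * affineGen 1 ^ 3 * (affineGen 0)⁻¹,
      affineGen 0 ^ 2 * affineGen 1 ^ 3 * (affineGen 0 ^ 2)⁻¹] : Fin 4 → PermAffine) i := by
    simp [Fin.forall_fin_succ, cuspElt, affineRep_gen]
  rw [h]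
  apply SemidirectProduct.ext <;> revert i <;> decide

theorem cuspElt_mem (i : Fin 4) : cuspElt i ∈ congruenceBraid3 3 := by
  rw [congruenceBraid3_three]
  fin_cases i
  · exact braidGen_zero_cube_mem
  · exact braidGen_one_cube_mem
  · exact Subgroup.Normal.conj_mem inferInstance _ braidGen_one_cube_mem _
  · exact Subgroup.Normal.conj_mem inferInstance _ braidGen_one_cube_mem _

/-- A word in the cusp elements. -/
def cuspProd (n : Fin 4 → ℤ) : BraidGroup3 :=
  cuspElt 0 ^ n 0 * cuspElt 1 ^ n 1 * cuspElt 2 ^ n 2 * cuspElt 3 ^ n 3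

theorem affineRep_cuspElt_zpow (i : Fin 4) (n : ℤ) :
    affineRep (cuspElt i ^ n) = permAffine (Pi.single i (6 * n)) 1 := by
  rw [map_zpow, affineRep_cuspElt, ← translationHom_apply, ← map_zpow, ← ofAdd_zsmul,
    translationHom_apply, permAffine_inj]
  refine ⟨?_, rfl⟩
  ext j
  by_cases h : j = i
  · subst h; simp [mul_comm]
  · simp [h]

theorem affineRep_cuspProd (n : Fin 4 → ℤ) : affineRep (cuspProd n) = permAffine (6 • n) 1 := by
  simp only [cuspProd, map_mul, affineRep_cuspElt_zpow, permAffine_mul, permAffine_inj]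
  refine ⟨?_, rfl⟩
  ext j
  change Pi.single (M := fun _ => ℤ) 0 (6 * n 0) j + Pi.single (M := fun _ => ℤ) 1 (6 * n 1) j +
    Pi.single (M := fun _ => ℤ) 2 (6 * n 2) j + Pi.single (M := fun _ => ℤ) 3 (6 * n 3) j = 6 * n j
  fin_cases j <;> simp

/-- The action of the generators by conjugation on four conjugates of `a³`. -/
theorem conj_cube_of_commute {G : Type*} [Group G] {a b : G} (h : a * b * a = b * a * b)
    (hc : Commute (a ^ 3) (b ^ 3)) (y : Fin 4 → G)
    (hy : y = ![a ^ 3, b ^ 3, a * b ^ 3 * a⁻¹, a ^ 2 * b ^ 3 * (a ^ 2)⁻¹]) (i : Fin 4) :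
    a * y i * a⁻¹ = y ((c[1, 2, 3] : Equiv.Perm (Fin 4)) i) ∧
      b * y i * b⁻¹ = y ((c[0, 3, 2] : Equiv.Perm (Fin 4)) i) := by
  have e1 : b * a * b⁻¹ = a⁻¹ * b * a := by
    rw [mul_inv_eq_iff_eq_mul, mul_assoc, mul_assoc, eq_inv_mul_iff_mul_eq, ← mul_assoc, h,
      mul_assoc]
  have e2 : b⁻¹ * a * b = a * b * a⁻¹ := by
    rw [eq_mul_inv_iff_mul_eq, mul_assoc, mul_assoc, inv_mul_eq_iff_eq_mul, ← mul_assoc, h,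
      mul_assoc]
  have e3 : (b * a) * b * (b * a)⁻¹ = a := by rw [mul_inv_eq_iff_eq_mul, ← h, mul_assoc]
  have e1' : b * a ^ 3 * b⁻¹ = a⁻¹ * b ^ 3 * a := by
    rw [← conj_pow, e1]
    simpa using conj_pow (a := a⁻¹) (b := b) (i := 3)
  have e2' : b⁻¹ * a ^ 3 * b = a * b ^ 3 * a⁻¹ := by
    rw [← conj_pow, ← e2]
    simpa using (conj_pow (a := b⁻¹) (b := a) (i := 3)).symm
  have e3' : (b * a) * b ^ 3 * (b * a)⁻¹ = a ^ 3 := by rw [← conj_pow, e3]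
  -- Conjugation by `a³` fixes `b³` and conversely, so conjugating exponents matter only modulo 3
  -- and the orbits close up into 3-cycles.
  have hc1 : a ^ 3 * b ^ 3 * (a ^ 3)⁻¹ = b ^ 3 := by rw [hc.eq, mul_inv_cancel_right]
  have hc2 : b ^ 3 * a ^ 3 * (b ^ 3)⁻¹ = a ^ 3 := by rw [← hc.eq, mul_inv_cancel_right]
  have e4 : b * a ^ 3 * b⁻¹ = a ^ 2 * b ^ 3 * (a ^ 2)⁻¹ := by
    rw [e1']
    nth_rw 1 [← hc1]
    group
  subst hy
  fin_cases i
  · exact ⟨by change a * a ^ 3 * a⁻¹ = a ^ 3; group, e4⟩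
  · exact ⟨rfl, by change b * b ^ 3 * b⁻¹ = b ^ 3; group⟩
  · exact ⟨by change a * (a * b ^ 3 * a⁻¹) * a⁻¹ = a ^ 2 * b ^ 3 * (a ^ 2)⁻¹; rw [pow_two]; group,
      by
        change b * (a * b ^ 3 * a⁻¹) * b⁻¹ = a ^ 3
        rw [← e3']; group⟩
  · refine ⟨?_, ?_⟩
    · change a * (a ^ 2 * b ^ 3 * (a ^ 2)⁻¹) * a⁻¹ = b ^ 3
      conv_rhs => rw [← hc1]
      rw [pow_succ' a 2]; group
    · change b * (a ^ 2 * b ^ 3 * (a ^ 2)⁻¹) * b⁻¹ = a * b ^ 3 * a⁻¹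
      rw [← e4, ← e2']
      have : b * (b * a ^ 3 * b⁻¹) * b⁻¹ = b ^ 2 * a ^ 3 * (b ^ 2)⁻¹ := by rw [pow_two]; group
      rw [this]
      conv_rhs => rw [← hc2]
      group

/-! ### The quotient by the commutator subgroup and its faithful affine action -/

/-- The quotient map to `B₃ / [B₃[3], B₃[3]]`. -/
def toQuotient : BraidGroup3 →* CongruenceQuotient3 3 := QuotientGroup.mk' _

theorem toQuotient_surjective : Function.Surjective toQuotient := QuotientGroup.mk'_surjective _

theorem ker_toQuotient : toQuotient.ker = ⁅congruenceBraid3 3, congruenceBraid3 3⁆ :=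
  QuotientGroup.ker_mk' _

theorem toQuotient_commute {x y : BraidGroup3} (hx : x ∈ congruenceBraid3 3)
    (hy : y ∈ congruenceBraid3 3) : Commute (toQuotient x) (toQuotient y) := by
  have := Subgroup.commutator_mem_commutator hx hy
  rw [← ker_toQuotient, MonoidHom.mem_ker, map_commutatorElement] at this
  exact commutatorElement_eq_one_iff_commute.1 this

theorem permRep_gen (i : Fin 2) : permRep (braidGen i) = (affineGen i).right := by
  rw [permRep, MonoidHom.comp_apply, affineRep_gen]; rfl

/-- Both sides are compatible with products and inverses in `g`, so the two generators suffice. This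
makes the linear part of the affine action agree with conjugation on the abelianized subgroup. -/
theorem toQuotient_conj_cuspElt (g : BraidGroup3) (i : Fin 4) :
    toQuotient g * toQuotient (cuspElt i) * (toQuotient g)⁻¹ =
      toQuotient (cuspElt (permRep g i)) := by
  have key := conj_cube_of_commute (a := toQuotient (braidGen 0)) (b := toQuotient (braidGen 1))
    (by simp only [← map_mul, braidGen_braid])
    (by simp only [← map_pow]; exact toQuotient_commute (cuspElt_mem 0) (cuspElt_mem 1))
    (fun i => toQuotient (cuspElt i))
    (by ext i; fin_cases i <;> simp [cuspElt])
  have hg : g ∈ Subgroup.closure {braidGen 0, braidGen 1} := closure_braidGen ▸ Subgroup.mem_top g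
  induction hg using Subgroup.closure_induction generalizing i with
  | mem x hx =>
    rcases hx with rfl | rfl
    · rw [permRep_gen]; exact (key i).1
    · rw [permRep_gen]; exact (key i).2
  | one => simp
  | mul x y _ _ hx hy =>
    rw [map_mul permRep, Equiv.Perm.mul_apply, ← hx, ← hy, map_mul]
    simp only [mul_assoc, _root_.mul_inv_rev]
  | inv x _ hx =>
    have := hx ((permRep x).symm i)
    rw [Equiv.apply_symm_apply] at this
    rw [map_inv permRep, Equiv.Perm.inv_def, ← this, map_inv]
    group

theorem toQuotient_cuspProd_add (n m : Fin 4 → ℤ) :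
    toQuotient (cuspProd (n + m)) = toQuotient (cuspProd n) * toQuotient (cuspProd m) := by
  have hc : ∀ i j (k l : ℤ),
      Commute (toQuotient (cuspElt i) ^ k) (toQuotient (cuspElt j) ^ l) := fun i j k l =>
    ((toQuotient_commute (cuspElt_mem i) (cuspElt_mem j)).zpow_left k).zpow_right l
  simp only [cuspProd, map_mul, map_zpow, Pi.add_apply, _root_.zpow_add]
  rw [Commute.mul_mul_mul_comm (((hc _ _ _ _).mul_right (hc _ _ _ _)).mul_right (hc _ _ _ _)),
    Commute.mul_mul_mul_comm ((hc _ _ _ _).mul_right (hc _ _ _ _)),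
    Commute.mul_mul_mul_comm (hc _ _ _ _)]

theorem cuspProd_zero : cuspProd 0 = 1 := by simp [cuspProd]

theorem cuspProd_single (i : Fin 4) : cuspProd (Pi.single i 1) = cuspElt i := by
  fin_cases i <;> simp [cuspProd]

/-- Every element of the congruence subgroup is a word in the cusp elements modulo commutators. -/
theorem exists_cuspProd {g : BraidGroup3} (hg : g ∈ congruenceBraid3 3) :
    ∃ n : Fin 4 → ℤ, toQuotient g = toQuotient (cuspProd n) := by
  rw [congruenceBraid3_three] at hg
  change g ∈ Subgroup.closure _ at hg
  induction hg using Subgroup.closure_induction with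
  | mem x hx =>
    obtain ⟨_, rfl, c, rfl⟩ := Group.mem_conjugatesOfSet_iff.1 hx |>.imp fun _ h => h.imp_right
      isConj_iff.1
    -- `σ₁³` is the cusp element of index 0, so its conjugate by `c` has the class of the one of
    -- index `permRep c 0`.
    refine ⟨Pi.single (permRep c 0) 1, ?_⟩
    rw [cuspProd_single, ← toQuotient_conj_cuspElt, map_mul, map_mul, map_inv]
    rfl
  | one => exact ⟨0, by rw [cuspProd_zero]⟩
  | mul x y _ _ hx hy =>
    obtain ⟨n, hn⟩ := hx
    obtain ⟨m, hm⟩ := hy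
    exact ⟨n + m, by rw [toQuotient_cuspProd_add, map_mul, hn, hm]⟩
  | inv x _ hx =>
    obtain ⟨n, hn⟩ := hx
    refine ⟨-n, ?_⟩
    rw [map_inv, hn, inv_eq_iff_mul_eq_one, ← toQuotient_cuspProd_add, add_neg_cancel,
      cuspProd_zero, map_one]

theorem congruenceBraid3_three_le_ker_permRep : congruenceBraid3 3 ≤ permRep.ker := by
  rw [congruenceBraid3_three]
  exact cubeClosure_le_ker _ (by rw [permRep_gen]; decide)

theorem permRep_fullTwist : permRep fullTwist = 1 := by
  rw [permRep, MonoidHom.comp_apply, affineRep_fullTwist]; rfl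

/-- The affine transformations representing the words `aⁱ w`. -/
theorem affineRep_tetraWord (i : Fin 3) (j : Fin 4) :
    affineRep (tetraWord (braidGen 0) (braidGen 1) i j) =
      tetraWord (affineGen 0) (affineGen 1) i j := by
  rw [map_tetraWord, affineRep_gen, affineRep_gen]

theorem permRep_tetraWord (i : Fin 3) (j : Fin 4) :
    permRep (tetraWord (braidGen 0) (braidGen 1) i j) =
      tetraWord c[1, 2, 3] c[0, 3, 2] i j := by
  rw [map_tetraWord, permRep_gen, permRep_gen]; rfl

theorem tetraWord_perm_eq_one {i : Fin 3} {j : Fin 4}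
    (h : tetraWord (c[1, 2, 3] : Equiv.Perm (Fin 4)) c[0, 3, 2] i j = 1) : i = 0 ∧ j = 0 := by
  revert i j; decide

theorem tetraWord_zero_zero {Q : Type*} [Group Q] (a b : Q) : tetraWord a b 0 0 = 1 := by
  simp [tetraWord]

/-- Elements of the quotient in normal form, and their images under the affine representation. -/
theorem exists_cusp_normal_form (g : BraidGroup3) :
    ∃ (n : Fin 4 → ℤ) (k : Fin 2) (i : Fin 3) (j : Fin 4),
      toQuotient g = toQuotient (cuspProd n) * (toQuotient fullTwist ^ (k : ℕ) *
        toQuotient (tetraWord (braidGen 0) (braidGen 1) i j)) := by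
  obtain ⟨n, hn, k, i, j, rfl⟩ := exists_braid_normal_form g
  rw [← congruenceBraid3_three] at hn
  obtain ⟨m, hm⟩ := exists_cuspProd hn
  exact ⟨m, k, i, j, by rw [map_mul, hm, map_mul, map_pow]⟩

/-- The congruence subgroup acts by translations, and these commute. -/
theorem ker_affineRep_ge : ⁅congruenceBraid3 3, congruenceBraid3 3⁆ ≤ affineRep.ker := by
  rw [Subgroup.commutator_le]
  intro x hx y hy
  have hx := congruenceBraid3_three_le_ker_permRep hx
  have hy := congruenceBraid3_three_le_ker_permRep hy
  rw [MonoidHom.mem_ker, permRep, MonoidHom.comp_apply] at hx hy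
  obtain ⟨v, p, hv⟩ := exists_permAffine (affineRep x)
  obtain ⟨w, q, hw⟩ := exists_permAffine (affineRep y)
  rw [hv] at hx
  rw [hw] at hy
  obtain rfl : p = 1 := hx
  obtain rfl : q = 1 := hy
  rw [MonoidHom.mem_ker, map_commutatorElement, commutatorElement_eq_one_iff_commute, hv, hw,
    ← translationHom_apply, ← translationHom_apply]
  exact (Commute.all _ _).map translationHom

theorem permAffine_pow_one (v : Fin 4 → ℤ) (k : ℕ) : permAffine v 1 ^ k = permAffine (k • v) 1 := by
  rw [← translationHom_apply, ← map_pow, ← ofAdd_nsmul, translationHom_apply]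

/-- The affine representation descends to the quotient. -/
def quotientRep : CongruenceQuotient3 3 →* PermAffine :=
  QuotientGroup.lift _ affineRep ker_affineRep_ge

theorem quotientRep_toQuotient (g : BraidGroup3) : quotientRep (toQuotient g) = affineRep g :=
  QuotientGroup.lift_mk' _ _ _

theorem exists_affineRep_eq (g : BraidGroup3) :
    ∃ (n : Fin 4 → ℤ) (k : Fin 2) (i : Fin 3) (j : Fin 4),
      toQuotient g = toQuotient (cuspProd n) * (toQuotient fullTwist ^ (k : ℕ) *
        toQuotient (tetraWord (braidGen 0) (braidGen 1) i j)) ∧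
      affineRep g = permAffine (fun l => 6 * n l + 3 * (k : ℕ)) 1 *
        tetraWord (affineGen 0) (affineGen 1) i j := by
  obtain ⟨n, k, i, j, h⟩ := exists_cusp_normal_form g
  refine ⟨n, k, i, j, h, ?_⟩
  have h' := congrArg quotientRep h
  simp only [map_mul, map_pow, quotientRep_toQuotient, affineRep_tetraWord] at h'
  rw [h', affineRep_cuspProd, affineRep_fullTwist, permAffine_pow_one, ← mul_assoc, permAffine_mul]
  congr 2
  ext l
  simp [mul_comm]

theorem tetraWord_affine_right (i : Fin 3) (j : Fin 4) :
    (tetraWord (affineGen 0) (affineGen 1) i j).right = tetraWord c[1, 2, 3] c[0, 3, 2] i j :=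
  map_tetraWord SemidirectProduct.rightHom _ _ i j

/-- Translations in the image of the affine representation. -/
theorem affineRep_right_eq_one {g : BraidGroup3} (h : (affineRep g).right = 1) :
    ∃ (n : Fin 4 → ℤ) (k : Fin 2),
      toQuotient g = toQuotient (cuspProd n) * toQuotient fullTwist ^ (k : ℕ) ∧
      affineRep g = permAffine (fun l => 6 * n l + 3 * (k : ℕ)) 1 := by
  obtain ⟨n, k, i, j, h1, h2⟩ := exists_affineRep_eq g
  have h3 : (affineRep g).right = tetraWord c[1, 2, 3] c[0, 3, 2] i j := by
    rw [h2, SemidirectProduct.mul_right, tetraWord_affine_right]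
    exact one_mul _
  obtain ⟨rfl, rfl⟩ := tetraWord_perm_eq_one (h3.symm.trans h)
  refine ⟨n, k, ?_, ?_⟩
  · rw [h1, tetraWord_zero_zero, map_one, mul_one]
  · rw [h2, tetraWord_zero_zero, mul_one]

/-- An element acting trivially has normal form with translation `6n + 3k(1, 1, 1, 1) = 0`. Parity
forces `k = 0`, and then `n = 0`. -/
theorem quotientRep_injective : Function.Injective quotientRep := by
  rw [injective_iff_map_eq_one]
  intro x hx
  obtain ⟨g, rfl⟩ := toQuotient_surjective x
  rw [quotientRep_toQuotient] at hx
  obtain ⟨n, k, h1, h2⟩ := affineRep_right_eq_one (g := g) (by rw [hx]; rfl)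
  rw [hx, ← permAffine_one, permAffine_inj] at h2
  have hn : ∀ l, 0 = 6 * n l + 3 * ((k : ℕ) : ℤ) := fun l => congrFun h2.1 l
  have hk := k.isLt
  have hk0 : (k : ℕ) = 0 := by have := hn 0; omega
  have hn0 : n = 0 := by
    ext l
    have := hn l
    simp only [Pi.zero_apply]
    omega
  rw [h1, hk0, hn0, cuspProd_zero, map_one, pow_zero, one_mul]

/-! ### Absence of torsion -/

theorem permAffine_pow (v : Fin 4 → ℤ) (p : Equiv.Perm (Fin 4)) (m : ℕ) :
    permAffine v p ^ m =
      permAffine (fun l => ∑ s ∈ Finset.range m, v ((p ^ s)⁻¹ l)) (p ^ m) := by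
  induction m with
  | zero => simp; rfl
  | succ m ih =>
    rw [pow_succ, ih, permAffine_mul, pow_succ, permAffine_inj]
    exact ⟨funext fun l => (Finset.sum_range_succ _ _).symm, rfl⟩

/-- The classes of the words `aⁱ w ≠ 1` have no representative of finite order: their sixth powers
have a coordinate that no translation in the image can cancel. -/
theorem tetraWord_affine_obstruction (i : Fin 3) (j : Fin 4) (h : ¬ (i = 0 ∧ j = 0)) :
    ∃ l : Fin 4, ((tetraWord c[1, 2, 3] c[0, 3, 2] i j : Equiv.Perm (Fin 4)) l = l ∨
        (tetraWord c[1, 2, 3] c[0, 3, 2] i j : Equiv.Perm (Fin 4)) ^ 2 = 1) ∧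
      ¬ (18 : ℤ) ∣ ((tetraWord (affineGen 0) (affineGen 1) i j) ^ 6).left.toAdd l := by
  revert i j
  decide +kernel

theorem tetraWord_perm_pow_six (i : Fin 3) (j : Fin 4) :
    (tetraWord c[1, 2, 3] c[0, 3, 2] i j : Equiv.Perm (Fin 4)) ^ 6 = 1 := by
  revert i j
  decide +kernel

/-- Translations have no torsion. Otherwise the linear part `p` satisfies `p⁶ = 1`, so the sixth
power is a translation and must vanish. At the coordinate `l` of the obstruction, the lattice part
contributes `18k` plus either `36 n l` (if `p` fixes `l`) or `18(n l + n(p⁻¹ l))` (if `p² = 1`), a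
multiple of 18, whereas the contribution of the word is not. -/
theorem affineRep_eq_one_of_isOfFinOrder {g : BraidGroup3} (h : IsOfFinOrder (affineRep g)) :
    affineRep g = 1 := by
  have htrans : ∀ u : Fin 4 → ℤ, IsOfFinOrder (permAffine u 1) → u = 0 := by
    intro u hu
    obtain ⟨m, hm, hu⟩ := isOfFinOrder_iff_pow_eq_one.1 hu
    rw [permAffine_pow_one, ← permAffine_one, permAffine_inj] at hu
    exact (smul_eq_zero.1 hu.1).resolve_left hm.ne'
  obtain ⟨n, k, i, j, -, h2⟩ := exists_affineRep_eq g
  by_cases hij : i = 0 ∧ j = 0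
  · obtain ⟨rfl, rfl⟩ := hij
    rw [tetraWord_zero_zero, mul_one] at h2
    rw [h2] at h ⊢
    rw [htrans _ h, permAffine_one]
  exfalso
  obtain ⟨l, hl, hdvd⟩ := tetraWord_affine_obstruction i j hij
  obtain ⟨v, p, hv⟩ := exists_permAffine (tetraWord (affineGen 0) (affineGen 1) i j)
  have hp : tetraWord c[1, 2, 3] c[0, 3, 2] i j = p := by
    rw [← tetraWord_affine_right, hv]; rfl
  have hp6 : p ^ 6 = 1 := hp ▸ tetraWord_perm_pow_six i j
  rw [hp] at hl
  rw [hv, permAffine_pow] at hdvd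
  change ¬ (18 : ℤ) ∣ ∑ s ∈ Finset.range 6, v ((p ^ s)⁻¹ l) at hdvd
  rw [hv, permAffine_mul, one_mul] at h2
  have h6 := h.pow (n := 6)
  rw [h2, permAffine_pow, hp6] at h6
  have hu := congrFun (htrans _ h6) l
  simp only [inv_one, Equiv.Perm.coe_one, id, Pi.zero_apply, Finset.sum_add_distrib] at hu
  have hn : (18 : ℤ) ∣ ∑ s ∈ Finset.range 6, 6 * n ((p ^ s)⁻¹ l) := by
    rcases hl with hl | hl
    · have hfix : ∀ s : ℕ, (p ^ s)⁻¹ l = l := fun s =>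
        Equiv.Perm.inv_eq_iff_eq.2 (Function.IsFixedPt.perm_pow hl s).eq.symm
      simp only [hfix, Finset.sum_const, Finset.card_range]
      exact ⟨2 * n l, by simp; ring⟩
    · have h3 : p ^ 3 = p := by rw [pow_succ, hl, one_mul]
      have h4 : p ^ 4 = 1 := by rw [pow_succ, h3, ← pow_two, hl]
      have h5 : p ^ 5 = p := by rw [pow_succ, h4, one_mul]
      simp only [Finset.sum_range_succ, Finset.sum_range_zero, hl, h3, h4, h5, pow_zero, pow_one,
        inv_one, Equiv.Perm.coe_one, id]
      exact ⟨n l + n (p⁻¹ l), by ring⟩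
  simp only [Finset.sum_const, Finset.card_range, nsmul_eq_mul, Nat.cast_ofNat] at hu
  omega

theorem quotient_torsionFree (x : CongruenceQuotient3 3) (hx : IsOfFinOrder x) : x = 1 := by
  apply quotientRep_injective
  obtain ⟨g, rfl⟩ := toQuotient_surjective x
  have := quotientRep.isOfFinOrder hx
  rw [quotientRep_toQuotient] at this
  rw [quotientRep_toQuotient, map_one, affineRep_eq_one_of_isOfFinOrder this]

theorem cuspProd_translation (n : Fin 4 → ℤ) (k : ℤ) :
    affineRep (cuspProd n * fullTwist ^ k) = permAffine (fun l => 6 * n l + 3 * k) 1 := by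
  rw [map_mul, affineRep_cuspProd, map_zpow, affineRep_fullTwist, ← translationHom_apply (fun _ => 3),
    ← map_zpow, ← ofAdd_zsmul, translationHom_apply, permAffine_mul, permAffine_inj]
  refine ⟨?_, rfl⟩
  ext l
  simp [mul_comm]

/-! ### The holonomy group -/

theorem permRep_range : permRep.range = alternatingGroup (Fin 4) := by
  apply le_antisymm
  · rw [MonoidHom.range_eq_map, ← closure_braidGen, MonoidHom.map_closure, Subgroup.closure_le,
      Set.image_pair, permRep_gen, permRep_gen]
    rintro _ (rfl | rfl)
    · exact Equiv.Perm.mem_alternatingGroup.2 (by decide)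
    · exact Equiv.Perm.mem_alternatingGroup.2 (by decide)
  · intro p hp
    -- The twelve words already exhaust the even permutations.
    have : ∃ i j, tetraWord c[1, 2, 3] c[0, 3, 2] i j = p := by
      rw [Equiv.Perm.mem_alternatingGroup] at hp
      revert p
      decide +kernel
    obtain ⟨i, j, rfl⟩ := this
    exact ⟨_, permRep_tetraWord i j⟩

/-- The image of the braid group in `PSp₂(ℤ/3)`. -/
def projRep : BraidGroup3 →* PSp2 (ZMod 3) :=
  (QuotientGroup.mk' (Subgroup.center (Sp2 (ZMod 3)))).comp (rhoMod 3)

/-- In rank two the symplectic condition is `ps - qr = 1`, which leaves a finite check on four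
entries modulo 3. -/
theorem sp2_eq_of_rho (A : Sp2 (ZMod 3)) : ∃ (k : Fin 2) (i : Fin 3) (j : Fin 4),
    rhoMod 3 (fullTwist ^ (k : ℕ) * tetraWord (braidGen 0) (braidGen 1) i j) = A := by
  have key : ∀ p q r s : ZMod 3, p * s - q * r = 1 → ∃ (k : Fin 2) (i : Fin 3) (j : Fin 4),
      (((Sp2.reduction 3 (rhoGen 0) * Sp2.reduction 3 (rhoGen 1) * Sp2.reduction 3 (rhoGen 0)) ^ 2) ^
          (k : ℕ) * tetraWord (Sp2.reduction 3 (rhoGen 0)) (Sp2.reduction 3 (rhoGen 1)) i j :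
          Sp2 (ZMod 3)).1 = fromBlocks !![p] !![q] !![r] !![s] := by
    decide +kernel
  obtain ⟨A, hA⟩ := A
  have hA' : A = fromBlocks !![A (.inl 0) (.inl 0)] !![A (.inl 0) (.inr 0)]
      !![A (.inr 0) (.inl 0)] !![A (.inr 0) (.inr 0)] := by
    ext i j
    rcases i with i | i <;> rcases j with j | j <;> fin_cases i <;> fin_cases j <;> rfl
  have hdet : A (.inl 0) (.inl 0) * A (.inr 0) (.inr 0) -
      A (.inl 0) (.inr 0) * A (.inr 0) (.inl 0) = 1 := by
    have := SymplecticGroup.mem_iff.1 hA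
    have := congrFun (congrFun this (.inl 0)) (.inr 0)
    simp [Matrix.mul_apply, J, Matrix.transpose_apply] at this
    linear_combination -this
  obtain ⟨k, i, j, h⟩ := key _ _ _ _ hdet
  refine ⟨k, i, j, Subtype.ext (Eq.trans ?_ (h.trans hA'.symm))⟩
  rw [fullTwist, map_mul, map_tetraWord, map_pow, map_pow, map_mul, map_mul, rhoMod_gen,
    rhoMod_gen]

theorem projRep_surjective : Function.Surjective projRep := by
  apply (QuotientGroup.mk'_surjective _).comp
  intro A
  obtain ⟨k, i, j, h⟩ := sp2_eq_of_rho A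
  exact ⟨_, h⟩

/-- The full twist commutes with both generators, and `ρ₃` is onto, so its image is central. -/
theorem projRep_fullTwist : projRep fullTwist = 1 := by
  refine (QuotientGroup.eq_one_iff _).2 (Subgroup.mem_center_iff.2 fun A => ?_)
  obtain ⟨k, i, j, rfl⟩ := sp2_eq_of_rho A
  have h0 : Commute fullTwist (braidGen 0) := fullTwist_commute_left braidGen_braid
  have h1 : Commute fullTwist (braidGen 1) := fullTwist_commute_right braidGen_braid
  have : Commute fullTwist (fullTwist ^ (k : ℕ) * tetraWord (braidGen 0) (braidGen 1) i j) := by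
    refine ((Commute.refl _).pow_right _).mul_right ((h0.pow_right _).mul_right ?_)
    fin_cases j
    · exact Commute.one_right _
    · exact h1
    · exact h1.mul_right h0
    · exact (h1.mul_right h0).mul_right h0
  exact (this.map (rhoMod 3)).eq.symm

theorem projRep_tetraWord_eq_one {i : Fin 3} {j : Fin 4}
    (hproj : projRep (tetraWord (braidGen 0) (braidGen 1) i j) = 1) : i = 0 ∧ j = 0 := by
  have h := Subgroup.mem_center_iff.1 ((QuotientGroup.eq_one_iff _).1 hproj)
  have h0 := congrArg Subtype.val (h (Sp2.reduction 3 (rhoGen 0)))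
  have h1 := congrArg Subtype.val (h (Sp2.reduction 3 (rhoGen 1)))
  rw [map_tetraWord, rhoMod_gen, rhoMod_gen] at h0 h1
  clear h hproj
  revert i j h0 h1
  decide +kernel

/-- Both maps kill the normal closure of `σ₁³` and the full twist, and both are nontrivial on every
word `aⁱw ≠ 1`. -/
theorem ker_projRep : projRep.ker = permRep.ker := by
  have hcl : cubeClosure ≤ projRep.ker := by
    rw [← congruenceBraid3_three]
    intro g hg
    rw [MonoidHom.mem_ker, projRep, MonoidHom.comp_apply, MonoidHom.mem_ker.1 hg, map_one]
  have hcl' : cubeClosure ≤ permRep.ker := congruenceBraid3_three ▸ congruenceBraid3_three_le_ker_permRep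
  ext g
  obtain ⟨n, hn, k, i, j, rfl⟩ := exists_braid_normal_form g
  have h1 := MonoidHom.mem_ker.1 (hcl hn)
  have h2 := MonoidHom.mem_ker.1 (hcl' hn)
  rw [MonoidHom.mem_ker, MonoidHom.mem_ker, map_mul, map_mul, map_mul, map_mul, map_pow, map_pow,
    h1, h2, projRep_fullTwist, permRep_fullTwist, one_pow, one_pow, one_mul, one_mul, one_mul,
    one_mul]
  constructor
  · intro h
    obtain ⟨rfl, rfl⟩ := projRep_tetraWord_eq_one h
    rw [tetraWord_zero_zero, map_one]
  · intro h
    rw [permRep_tetraWord] at h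
    obtain ⟨rfl, rfl⟩ := tetraWord_perm_eq_one h
    rw [tetraWord_zero_zero, map_one]

/-- Surjections with equal kernels have isomorphic targets; here the target of the first is its
range. -/
theorem nonempty_range_mulEquiv {G H F : Type*} [Group G] [Group H] [Group F] (f : G →* F)
    (hf : Function.Surjective f) (g : G →* H) (h : f.ker = g.ker) : Nonempty (g.range ≃* F) :=
  ⟨((QuotientGroup.quotientKerEquivRange g).symm.trans
    (QuotientGroup.quotientMulEquivOfEq h.symm)).trans
    (QuotientGroup.quotientKerEquivOfSurjective f hf)⟩

theorem nonempty_PSp2_mulEquiv : Nonempty (PSp2 (ZMod 3) ≃* alternatingGroup (Fin 4)) := by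
  obtain ⟨e⟩ := nonempty_range_mulEquiv projRep projRep_surjective permRep ker_projRep
  exact ⟨e.symm.trans (MulEquiv.subgroupCongr permRep_range)⟩

/-! ### The Euclidean action -/

/-- Permutation of the coordinates. -/
noncomputable def permIsom : Equiv.Perm (Fin 4) →* (Euc 4 ≃ₗᵢ[ℝ] Euc 4) where
  toFun p := LinearIsometryEquiv.piLpCongrLeft 2 ℝ ℝ p
  map_one' := by
    ext x i
    simp [LinearIsometryEquiv.piLpCongrLeft_apply, Equiv.piCongrLeft'_apply]
    rfl
  map_mul' _ _ := by
    ext x i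
    simp [LinearIsometryEquiv.piLpCongrLeft_apply, Equiv.piCongrLeft'_apply]
    rfl

theorem permIsom_apply (p : Equiv.Perm (Fin 4)) (x : Euc 4) (i : Fin 4) :
    permIsom p x i = x (p⁻¹ i) := by
  simp [permIsom, LinearIsometryEquiv.piLpCongrLeft_apply, Equiv.piCongrLeft'_apply]

/-- The translation by one sixth of an integer vector. -/
noncomputable def sixthVec (v : Fin 4 → ℤ) : Euc 4 := WithLp.toLp 2 fun i => (v i : ℝ) / 6

theorem sixthVec_apply (v : Fin 4 → ℤ) (i : Fin 4) : sixthVec v i = (v i : ℝ) / 6 := rfl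

/-- The isometry `x ↦ p x + v / 6` of Euclidean space. -/
noncomputable def permAffineIsom : PermAffine →* EucIsom 4 where
  toFun g := AffineIsometryEquiv.constVAdd ℝ (Euc 4) (sixthVec g.left.toAdd) *
    (permIsom g.right).toAffineIsometryEquiv
  map_one' := by
    ext x i
    simp [sixthVec_apply]
  map_mul' g h := by
    ext x i
    simp [permIsom_apply, sixthVec_apply, permAction]
    ring

theorem permAffineIsom_apply (v : Fin 4 → ℤ) (p : Equiv.Perm (Fin 4)) (x : Euc 4) (i : Fin 4) :
    permAffineIsom (permAffine v p) x i = v i / 6 + x (p⁻¹ i) := by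
  rw [← permIsom_apply]; rfl

theorem linearPart_permAffineIsom (v : Fin 4 → ℤ) (p : Equiv.Perm (Fin 4)) :
    EucIsom.linearPart 4 (permAffineIsom (permAffine v p)) = permIsom p := by
  ext x i
  rfl

theorem permIsom_injective : Function.Injective permIsom := by
  intro p q h
  ext i : 1
  let x : Euc 4 := EuclideanSpace.single i 1
  have h1 : permIsom p x (p i) = permIsom q x (p i) := by rw [h]
  rw [permIsom_apply, permIsom_apply, Equiv.Perm.inv_eq_iff_eq.2 rfl] at h1
  by_contra hne
  have h2 : q⁻¹ (p i) ≠ i := fun h => hne (Equiv.Perm.inv_eq_iff_eq.1 h)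
  simp [x] at h1
  exact h2 h1

theorem sixthVec_injective : Function.Injective sixthVec := by
  intro v w h
  ext i
  have := congrArg (fun x : Euc 4 => x i) h
  simpa [sixthVec_apply] using this

theorem permAffineIsom_zero (v : Fin 4 → ℤ) (p : Equiv.Perm (Fin 4)) :
    permAffineIsom (permAffine v p) 0 = sixthVec v := by
  ext i
  simp [permAffineIsom_apply, sixthVec_apply]

theorem permAffineIsom_injective : Function.Injective permAffineIsom := by
  intro g h hgh
  obtain ⟨v, p, rfl⟩ := exists_permAffine g
  obtain ⟨w, q, rfl⟩ := exists_permAffine h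
  rw [permAffine_inj]
  constructor
  · apply sixthVec_injective
    rw [← permAffineIsom_zero v p, hgh, permAffineIsom_zero]
  · apply permIsom_injective
    rw [← linearPart_permAffineIsom v p, hgh, linearPart_permAffineIsom]

theorem EucIsom.apply_eq_linearPart_add {N : ℕ} (g : EucIsom N) (x : Euc N) :
    g x = EucIsom.linearPart N g x + g 0 := by
  have := g.map_vadd 0 x
  simp only [vadd_eq_add, add_zero] at this
  exact this

theorem EucIsom.continuous_apply {N : ℕ} (x : Euc N) : Continuous fun g : EucIsom N => g x := by
  have h : Continuous (EucIsom.parts N) := continuous_induced_dom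
  have : (fun g : EucIsom N => g x) = fun g => (EucIsom.parts N g).2 x + (EucIsom.parts N g).1 :=
    funext fun g => g.apply_eq_linearPart_add x
  rw [this]
  exact (h.snd.clm_apply continuous_const).add h.fst

/-! ### Discreteness -/

/-- Such an isometry is determined by its values at two points, and six times their coordinates are
integers; evaluation is thus a continuous injection into a discrete space. -/
theorem discreteTopology_of_le_range_permAffineIsom {Γ : Subgroup (EucIsom 4)}
    (hΓ : Γ ≤ permAffineIsom.range) : DiscreteTopology Γ := by
  choose m hm using fun γ : Γ => hΓ γ.2
  -- The points are the origin, which detects the translation, and `(0, 1, 2, 3)`, whose distinct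
  -- coordinates detect the permutation.
  let x : Fin 2 → Euc 4 := fun s => sixthVec fun i => (s : ℕ) * 6 * (i : ℕ)
  let F : Γ → Fin 2 → Fin 4 → ℤ := fun γ s i =>
    (m γ).left.toAdd i + (s : ℕ) * 6 * (((m γ).right⁻¹ i : Fin 4) : ℕ)
  have hF : ∀ γ s i, ((F γ s i : ℤ) : ℝ) = 6 * (γ : EucIsom 4) (x s) i := by
    intro γ s i
    rw [← hm γ]
    change _ = 6 * permAffineIsom (permAffine (m γ).left.toAdd (m γ).right) (x s) i
    rw [permAffineIsom_apply, sixthVec_apply]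
    push_cast [F]
    ring
  have hcont : Continuous F := by
    refine continuous_pi fun s => continuous_pi fun i => ?_
    rw [Int.isClosedEmbedding_coe_real.isInducing.continuous_iff]
    have : (Int.cast ∘ fun γ => F γ s i) = fun γ : Γ => 6 * (γ : EucIsom 4) (x s) i :=
      funext fun γ => hF γ s i
    rw [this]
    have h1 : Continuous fun γ : Γ => (γ : EucIsom 4) (x s) :=
      (EucIsom.continuous_apply (x s)).comp continuous_subtype_val
    fun_prop
  refine DiscreteTopology.of_continuous_injective hcont fun γ δ h => ?_
  have h0 : ∀ i, (m γ).left.toAdd i = (m δ).left.toAdd i := fun i => by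
    simpa [F] using congrFun (congrFun h 0) i
  have h1 : (m γ).right⁻¹ = (m δ).right⁻¹ := by
    ext i
    have := congrFun (congrFun h 1) i
    simp only [F, h0] at this
    simp at this
    omega
  have : m γ = m δ := SemidirectProduct.ext (funext h0) (inv_injective h1)
  exact Subtype.ext (by rw [← hm γ, this, hm])

/-! ### Cocompactness -/

/-- The topology is induced from pairs (translation, linear map), where this set becomes a closed
ball times the norm-preserving maps, a closed bounded set in finite dimension. -/
theorem EucIsom.isCompact_setOf_norm_le (N : ℕ) (r : ℝ) :
    IsCompact {g : EucIsom N | ‖g 0‖ ≤ r} := by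
  have hind : Topology.IsInducing (EucIsom.parts N) := ⟨rfl⟩
  rw [hind.isCompact_iff]
  have hO : IsCompact {A : Euc N →L[ℝ] Euc N | ∀ x, ‖A x‖ = ‖x‖} := by
    apply Metric.isCompact_of_isClosed_isBounded
    · simp only [Set.ofPred_forall]
      exact isClosed_iInter fun x => isClosed_eq (by fun_prop) continuous_const
    · refine (Metric.isBounded_closedBall (x := 0) (r := 1)).subset fun A hA => ?_
      rw [mem_closedBall_zero_iff]
      exact A.opNorm_le_bound zero_le_one fun x => by rw [hA x, one_mul]
  convert (isCompact_closedBall (0 : Euc N) r).prod hO using 1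
  ext ⟨v, A⟩
  simp only [Set.mem_image, Set.mem_prod, mem_closedBall_zero_iff, Set.mem_ofPred_eq]
  constructor
  · rintro ⟨g, hg, h⟩
    obtain ⟨rfl, rfl⟩ := Prod.mk.inj h
    exact ⟨hg, fun x => g.linearIsometryEquiv.norm_map x⟩
  · rintro ⟨hv, hA⟩
    let L : Euc N →ₗᵢ[ℝ] Euc N := ⟨A, hA⟩
    let g : EucIsom N := AffineIsometryEquiv.constVAdd ℝ (Euc N) v *
      (L.toLinearIsometryEquiv rfl).toAffineIsometryEquiv
    have hg : g 0 = v := by simp [g]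
    refine ⟨g, by rw [hg]; exact hv, Prod.ext hg ?_⟩
    ext1 x
    rfl

theorem compactSpace_quotient_of_translations {Γ : Subgroup (EucIsom 4)}
    (hΓ : ∀ n : Fin 4 → ℤ, permAffineIsom (permAffine (6 • n) 1) ∈ Γ) :
    CompactSpace (EucIsom 4 ⧸ Γ) := by
  refine ⟨?_⟩
  have hc := (EucIsom.isCompact_setOf_norm_le 4 2).image
    (QuotientGroup.continuous_mk (N := Γ))
  suffices h : (QuotientGroup.mk '' {g : EucIsom 4 | ‖g 0‖ ≤ 2} : Set (EucIsom 4 ⧸ Γ)) = Set.univ by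
    rwa [h] at hc
  rw [Set.eq_univ_iff_forall]
  intro y
  obtain ⟨g, rfl⟩ := QuotientGroup.mk_surjective y
  -- The cosets are `gΓ`, so `g` may be changed by a translation `t` on the right. Then `‖g(t 0)‖`
  -- is the distance from `t 0` to `g⁻¹ 0`; rounding down each of the four coordinates keeps it at
  -- most `√4 = 2`.
  let w : Euc 4 := g⁻¹ 0
  let n : Fin 4 → ℤ := fun i => ⌊w i⌋
  refine ⟨g * permAffineIsom (permAffine (6 • n) 1), ?_, ?_⟩
  · change ‖g (permAffineIsom (permAffine (6 • n) 1) 0)‖ ≤ 2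
    rw [permAffineIsom_zero]
    have hw : g w = 0 := g.apply_symm_apply 0
    rw [← sub_zero (g _), ← hw, ← dist_eq_norm, g.dist_map, EuclideanSpace.dist_eq]
    rw [Real.sqrt_le_iff]
    refine ⟨by norm_num, ?_⟩
    have hi : ∀ i, dist (sixthVec (6 • n) i) (w i) ^ 2 ≤ 1 := by
      intro i
      have h1 := Int.floor_le (w i)
      have h2 := Int.lt_floor_add_one (w i)
      have : sixthVec (6 • n) i = ⌊w i⌋ := by
        rw [sixthVec_apply]; simp [n]
      rw [this, Real.dist_eq, sq_abs]
      nlinarith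
    calc _ ≤ ∑ _i : Fin 4, (1 : ℝ) := Finset.sum_le_sum fun i _ => hi i
      _ = 2 ^ 2 := by simp; norm_num
  · exact QuotientGroup.mk_mul_of_mem g (hΓ n)

/-! ### The crystallographic group -/

/-- The isometric action of `B₃ / [B₃[3], B₃[3]]` on Euclidean space. -/
noncomputable def eucRep : CongruenceQuotient3 3 →* EucIsom 4 := permAffineIsom.comp quotientRep

theorem eucRep_injective : Function.Injective eucRep :=
  permAffineIsom_injective.comp quotientRep_injective

theorem eucRep_toQuotient (g : BraidGroup3) :
    eucRep (toQuotient g) = permAffineIsom (affineRep g) := by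
  rw [eucRep, MonoidHom.comp_apply, quotientRep_toQuotient]

theorem isCrystallographicSubgroup_eucRep : IsCrystallographicSubgroup eucRep.range where
  discrete := discreteTopology_of_le_range_permAffineIsom (by
    rintro _ ⟨x, rfl⟩
    exact ⟨quotientRep x, rfl⟩)
  uniform := compactSpace_quotient_of_translations fun n =>
    ⟨toQuotient (cuspProd n), by rw [eucRep_toQuotient, affineRep_cuspProd]⟩

/-! ### The translation lattice and the holonomy -/

/-- The translation lattice, spanned by three cusp elements and the full twist, in units of one
sixth. -/
def latticeHom : (Fin 4 → ℤ) →+ (Fin 4 → ℤ) where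
  toFun m := fun i => 6 * (![m 0, m 1, m 2, 0] i) + 3 * m 3
  map_zero' := by ext i; fin_cases i <;> simp
  map_add' m n := by ext i; fin_cases i <;> simp <;> ring

theorem latticeHom_injective : Function.Injective latticeHom := by
  rw [injective_iff_map_eq_zero]
  intro m h
  have h0 : 6 * m 0 + 3 * m 3 = 0 := congrFun h 0
  have h1 : 6 * m 1 + 3 * m 3 = 0 := congrFun h 1
  have h2 : 6 * m 2 + 3 * m 3 = 0 := congrFun h 2
  have h3 : 6 * 0 + 3 * m 3 = 0 := congrFun h 3
  ext i
  fin_cases i <;> simp <;> omega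

/-- The translations by vectors of the lattice. -/
noncomputable def latticeIsom : Multiplicative (Fin 4 → ℤ) →* EucIsom 4 :=
  permAffineIsom.comp (translationHom.comp (AddMonoidHom.toMultiplicative latticeHom))

theorem latticeIsom_apply (m : Fin 4 → ℤ) : latticeIsom (Multiplicative.ofAdd m) =
    permAffineIsom (permAffine (latticeHom m) 1) := rfl

theorem latticeIsom_injective : Function.Injective latticeIsom :=
  permAffineIsom_injective.comp (SemidirectProduct.inl_injective.comp latticeHom_injective)

theorem map_translationSubgroup_eucRep :
    (translationSubgroup eucRep.range).map eucRep.range.subtype = latticeIsom.range := by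
  ext f
  constructor
  · rintro ⟨⟨f, x, rfl⟩, hf, rfl⟩
    obtain ⟨g, rfl⟩ := toQuotient_surjective x
    have hf : EucIsom.linearPart 4 (eucRep (toQuotient g)) = 1 := hf
    rw [eucRep_toQuotient] at hf
    have hg : (affineRep g).right = 1 := by
      apply permIsom_injective
      obtain ⟨v, p, h⟩ := exists_permAffine (affineRep g)
      rw [h, linearPart_permAffineIsom] at hf
      rw [h, map_one]
      exact hf
    obtain ⟨n, k, -, h⟩ := affineRep_right_eq_one hg
    -- The fourth unit vector is not in the chosen basis; it equals twice `(½, ½, ½, ½)` minus the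
    -- other three.
    refine ⟨Multiplicative.ofAdd ![n 0 - n 3, n 1 - n 3, n 2 - n 3, (k : ℕ) + 2 * n 3], ?_⟩
    change _ = eucRep (toQuotient g)
    rw [latticeIsom_apply, eucRep_toQuotient, h]
    congr 2
    ext i
    fin_cases i <;> simp [latticeHom] <;> ring
  · rintro ⟨m, rfl⟩
    obtain ⟨m, rfl⟩ := Multiplicative.ofAdd.surjective m
    refine ⟨⟨latticeIsom (Multiplicative.ofAdd m),
      toQuotient (cuspProd ![m 0, m 1, m 2, 0] * fullTwist ^ m 3), ?_⟩, ?_, rfl⟩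
    · rw [eucRep_toQuotient, cuspProd_translation]; rfl
    · change EucIsom.linearPart 4 (latticeIsom (Multiplicative.ofAdd m)) = 1
      rw [latticeIsom_apply, linearPart_permAffineIsom, map_one]

theorem nonempty_translationSubgroup_mulEquiv :
    Nonempty (translationSubgroup eucRep.range ≃* Multiplicative (Fin 4 → ℤ)) :=
  ⟨((Subgroup.equivMapOfInjective _ _ (Subgroup.subtype_injective _)).trans
    (MulEquiv.subgroupCongr map_translationSubgroup_eucRep)).trans
    (MonoidHom.ofInjective latticeIsom_injective).symm⟩

/-- An element commuting with the unit translation along axis `i` has a linear part fixing `i`. All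
four unit translations lie in the group, so a commutative subgroup containing them has only trivial
linear parts. -/
theorem translationSubgroup_maximal : Maximal (fun A : Subgroup eucRep.range => IsMulCommutative A)
    (translationSubgroup eucRep.range) := by
  obtain ⟨e⟩ := nonempty_translationSubgroup_mulEquiv
  refine ⟨⟨⟨fun a b => e.injective (by rw [map_mul, map_mul, mul_comm])⟩⟩, fun A hA hle => ?_⟩
  rintro ⟨_, x, rfl⟩ ha
  obtain ⟨g, rfl⟩ := toQuotient_surjective x
  obtain ⟨v, p, hg⟩ := exists_permAffine (affineRep g)
  have hp : p⁻¹ = 1 := by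
    ext1 i
    let t : eucRep.range := ⟨eucRep (toQuotient (cuspElt i)), _, rfl⟩
    have ht : t ∈ A := by
      apply hle
      change EucIsom.linearPart 4 (eucRep (toQuotient (cuspElt i))) = 1
      rw [eucRep_toQuotient, affineRep_cuspElt, linearPart_permAffineIsom, map_one]
    have hcomm := hA.is_comm.comm ⟨_, ha⟩ ⟨t, ht⟩
    have hcomm : eucRep (toQuotient g) * eucRep (toQuotient (cuspElt i)) =
        eucRep (toQuotient (cuspElt i)) * eucRep (toQuotient g) :=
      congrArg (fun z : A => ((z : eucRep.range) : EucIsom 4)) hcomm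
    rw [eucRep_toQuotient, eucRep_toQuotient, affineRep_cuspElt, hg, ← map_mul, ← map_mul] at hcomm
    have hcomm := permAffineIsom_injective hcomm
    rw [permAffine_mul, permAffine_mul, permAffine_inj] at hcomm
    have h : v i + Pi.single (M := fun _ => ℤ) i 6 (p⁻¹ i) =
        Pi.single (M := fun _ => ℤ) i 6 i + v i := congrFun hcomm.1 i
    by_contra hne
    have hne : p⁻¹ i ≠ i := hne
    rw [Pi.single_eq_same, Pi.single_eq_of_ne hne] at h
    omega
  change EucIsom.linearPart 4 (eucRep (toQuotient g)) = 1
  rw [eucRep_toQuotient, hg, linearPart_permAffineIsom, inv_eq_one.1 hp, map_one]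

theorem holonomyGroup_eucRep : holonomyGroup eucRep.range = (permIsom.comp permRep).range := by
  have key : ∀ g, EucIsom.linearPart 4 (eucRep (toQuotient g)) = permIsom (permRep g) := by
    intro g
    obtain ⟨v, p, hg⟩ := exists_permAffine (affineRep g)
    rw [eucRep_toQuotient, permRep, MonoidHom.comp_apply, hg, linearPart_permAffineIsom]
    rfl
  ext L
  constructor
  · rintro ⟨_, ⟨x, rfl⟩, rfl⟩
    obtain ⟨g, rfl⟩ := toQuotient_surjective x
    exact ⟨g, (key g).symm⟩
  · rintro ⟨g, rfl⟩
    exact ⟨_, ⟨toQuotient g, rfl⟩, key g⟩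

theorem nonempty_holonomyGroup_mulEquiv :
    Nonempty (holonomyGroup eucRep.range ≃* PSp2 (ZMod 3)) := by
  rw [holonomyGroup_eucRep]
  exact nonempty_range_mulEquiv projRep projRep_surjective _
    (by
      rw [ker_projRep]
      ext g
      simp only [MonoidHom.mem_ker, MonoidHom.comp_apply]
      rw [map_eq_one_iff _ permIsom_injective])

theorem theorem2 :
    IsBieberbachGroup (CongruenceQuotient3 3) ∧
    IsCrystallographicOfDimWithHolonomy 4 (PSp2 (ZMod 3)) (CongruenceQuotient3 3) ∧
    Nonempty (PSp2 (ZMod 3) ≃* alternatingGroup (Fin 4)) := by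
  have e : Nonempty (CongruenceQuotient3 3 ≃* eucRep.range) :=
    ⟨MonoidHom.ofInjective eucRep_injective⟩
  refine ⟨⟨⟨4, _, isCrystallographicSubgroup_eucRep, e⟩, quotient_torsionFree⟩,
    ⟨_, isCrystallographicSubgroup_eucRep, e, nonempty_holonomyGroup_mulEquiv, ?_,
      nonempty_translationSubgroup_mulEquiv, translationSubgroup_maximal⟩, nonempty_PSp2_mulEquiv⟩
  obtain ⟨f⟩ := nonempty_PSp2_mulEquiv
  exact Finite.of_equiv _ f.symm.toEquiv
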